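/- All graphs are finite and simple. For graphs $G$ and $H$, a spanning subgraph $F\subseteq G$ is called weakly $(G,H)$-saturated if there is an ordering $e_1,\dots,e_m$ of the edges of $G$ that are not in $F$ such that, for every $i\in\{1,\dots,m\}$, the graph $F\cup\{e_1,\dots,e_i\}$ contains a (not necessarily induced) copy of $H$ that contains the edge $e_i$. Let $\delta(H)$ denote the minimum degree of $H$, let $K_n$ be the complete graph on $[n]=\{1,\dots,n\}$, and let $G(n,p)$ be the binomial random graph on $[n]$, in which every pair of distinct vertices is adjacent with probability $p$ independently of the others. Theorem. Let $H$ be a graph without isolated vertices, and let $p\in(0,1)$ and $C>0$ be constants. For every $n\in\mathbb{N}$, let $F^0_n$ be a weakly $(K_n,H)$-saturated graph containing a set of vertices $S^0_n\subseteq[n]$ of size at most $C$ such that every vertex in $[n]\setminus S^0_n$ is adjacent in $F^0_n$ to at least $\delta(H)-1$ vertices of $S^0_n$. Then, with probability tending to $1$ as $n\to\infty$, there exists a weakly $(G(n,p),H)$-saturated spanning subgraph $F_n\subseteq G(n,p)$ with exactly $\min\{|E(G(n,p))|,|E(F^0_n)|\}$ edges. -/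

import Mathlib

open Filter Topology

/-- One step of the `H`-bootstrap percolation process: `F'` is obtained from `F` by adding a new
edge `uv`, and this edge belongs to a copy of `H` in `F'` (that is, it is the image of an edge of
`H` under an injective homomorphism from `H` to `F'`). -/
def BootstrapStep {V W : Type*} (H : SimpleGraph V) (F F' : SimpleGraph W) : Prop :=
  ∃ u v : W, u ≠ v ∧ ¬ F.Adj u v ∧ F' = F ⊔ SimpleGraph.edge u v ∧
    ∃ f : SimpleGraph.Copy H F', ∃ x y : V, H.Adj x y ∧ f x = u ∧ f y = v

/-- The spanning subgraph `F` of `G` is weakly `(G, H)`-saturated: there is a finite sequence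
`F = F₀, F₁, …, F_m = G` in which each graph is obtained from the previous one by a step of the
`H`-bootstrap percolation process. -/
def IsWeaklySaturated {V W : Type*} (G : SimpleGraph W) (H : SimpleGraph V)
    (F : SimpleGraph W) : Prop :=
  F ≤ G ∧ Relation.ReflTransGen (BootstrapStep H) F G

/-! The bounded sets `S₀ n` force `F₀ n` to have at least `(n - C)(δ(H) - 1)` edges, so the excess
over `n(δ(H) - 1)` is bounded below and is minimised over `n ≥ |V(H)|` at some fixed `m`
(`exists_forall_le_add_mul`). It therefore suffices to find, in the random graph, a weakly saturated
subgraph costing one copy of `F₀ m` plus `δ(H) - 1` edges per further vertex; surplus edges can be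
added freely.

With high probability any `r` vertices have a common neighbour, for the constant `r = m + 3|V(H)|`.
From this deterministic property, take a clique `K` of order `m`, put `F₀ m` on it, and attach a
star to each other vertex: inside `K` if the vertex sees all of `K`, otherwise ending in a clique of
common neighbours of the vertex and `K`. After `K` fills up, `IsBootstrapClosed.adj_of_isClique`
spreads the process to all of `G` (`IsBootstrapClosed.eq_of_stars`). -/

/-! ### Closed graphs and weak saturation. -/

open SimpleGraph in
/-- `F` is closed under the `H`-bootstrap percolation process inside `G`. -/
def IsBootstrapClosed {V W : Type*} (H : SimpleGraph V) (G F : SimpleGraph W) : Prop :=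
  ∀ u v : W, G.Adj u v → ∀ f : Copy H (F ⊔ edge u v), ∀ x y : V, H.Adj x y →
    f x = u → f y = v → F.Adj u v

/-- If `F'` is closed inside `G'`, then a percolation process whose initial graph embeds in `F'`
and whose final graph embeds in `G'` has its final graph embedded in `F'`. -/
theorem IsBootstrapClosed.le_comap_of_reflTransGen {V W W' : Type*} {H : SimpleGraph V}
    {G' F' : SimpleGraph W'} (hF' : IsBootstrapClosed H G' F') (ι : W ↪ W')
    {F E : SimpleGraph W} (h : Relation.ReflTransGen (BootstrapStep H) F E)
    (hF : F ≤ F'.comap ι) (hE : E ≤ G'.comap ι) : E ≤ F'.comap ι := by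
  induction h with
  | refl => exact hF
  | @tail E₁ E₂ _ hstep ih =>
    obtain ⟨u, v, huv, -, rfl, f, x, y, hxy, hx, hy⟩ := hstep
    have h₁ := ih (le_sup_left.trans hE)
    have hcomap : E₁ ⊔ SimpleGraph.edge u v ≤
        (F' ⊔ SimpleGraph.edge (ι u) (ι v)).comap ι := by
      intro a b hab
      rw [SimpleGraph.sup_adj] at hab
      rw [SimpleGraph.comap_adj, SimpleGraph.sup_adj]
      rcases hab with hab | hab
      · exact Or.inl (h₁ hab)
      · right
        rw [SimpleGraph.edge_adj] at hab ⊢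
        refine ⟨?_, fun h => hab.2 (ι.injective h)⟩
        rcases hab.1 with ⟨rfl, rfl⟩ | ⟨rfl, rfl⟩ <;> simp
    have hG : G'.Adj (ι u) (ι v) := by
      refine hE (show (E₁ ⊔ SimpleGraph.edge u v).Adj u v from ?_)
      rw [SimpleGraph.sup_adj, SimpleGraph.edge_adj]
      exact Or.inr ⟨Or.inl ⟨rfl, rfl⟩, huv⟩
    let g : SimpleGraph.Copy H (F' ⊔ SimpleGraph.edge (ι u) (ι v)) :=
      ⟨⟨fun a => ι (f a), fun {a b} hab => hcomap (f.toHom.map_adj hab)⟩,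
        fun a b hab => f.injective (ι.injective hab)⟩
    have hadj : F'.Adj (ι u) (ι v) :=
      hF' (ι u) (ι v) hG g x y hxy (congrArg ι hx) (congrArg ι hy)
    refine sup_le h₁ fun a b hab => ?_
    rw [SimpleGraph.edge_adj] at hab
    rcases hab.1 with ⟨rfl, rfl⟩ | ⟨rfl, rfl⟩
    · exact hadj
    · exact hadj.symm

/-- On finite vertex sets, a spanning subgraph is weakly saturated if and only if the only closed
graph containing it is the whole host graph. -/
theorem isWeaklySaturated_iff_forall_closed {V W : Type*} [Finite W] {H : SimpleGraph V}
    {G F : SimpleGraph W} :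
    IsWeaklySaturated G H F ↔
      F ≤ G ∧ ∀ F' : SimpleGraph W, F ≤ F' → F' ≤ G → IsBootstrapClosed H G F' → F' = G := by
  constructor
  · rintro ⟨hFG, h⟩
    refine ⟨hFG, fun F' hFF' hF'G hF' => le_antisymm hF'G ?_⟩
    exact fun a b hab => hF'.le_comap_of_reflTransGen (Function.Embedding.refl W) h
      (fun _ _ h => hFF' h) (fun _ _ h => h) hab
  · rintro ⟨hFG, h⟩
    refine ⟨hFG, ?_⟩
    have hfin : {E : SimpleGraph W | E ≤ G ∧ Relation.ReflTransGen (BootstrapStep H) F E}.Finite :=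
      Set.toFinite _
    -- A maximal graph reachable from `F` inside `G` is closed, since any violation of closedness
    -- would be a further step.
    obtain ⟨E, ⟨hEG, hFE⟩, hmax⟩ := hfin.exists_maximal ⟨F, hFG, .refl⟩
    have hle : F ≤ E := by
      clear hmax hEG
      induction hFE with
      | refl => exact le_rfl
      | tail _ hs ih =>
        obtain ⟨u, v, -, -, rfl, -⟩ := hs
        exact ih.trans le_sup_left
    have hclosed : IsBootstrapClosed H G E := by
      intro u v huv f x y hxy hx hy
      by_contra hE
      have hmem : E ⊔ SimpleGraph.edge u v ∈
          {E : SimpleGraph W | E ≤ G ∧ Relation.ReflTransGen (BootstrapStep H) F E} := by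
        refine ⟨sup_le hEG fun a b hab => ?_, hFE.tail ⟨u, v, huv.ne, hE, rfl, f, x, y, hxy, hx, hy⟩⟩
        rw [SimpleGraph.edge_adj] at hab
        rcases hab.1 with ⟨rfl, rfl⟩ | ⟨rfl, rfl⟩
        · exact huv
        · exact huv.symm
      refine hE (hmax hmem le_sup_left (show (E ⊔ SimpleGraph.edge u v).Adj u v from ?_))
      rw [SimpleGraph.sup_adj, SimpleGraph.edge_adj]
      exact Or.inr ⟨Or.inl ⟨rfl, rfl⟩, huv.ne⟩
    rw [← h E hle hEG hclosed]
    exact hFE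

/-- The closed graphs above `F'` are among those above `F`, so no percolation sequence has to be
rearranged. -/
theorem IsWeaklySaturated.mono {V W : Type*} [Finite W] {H : SimpleGraph V}
    {G F F' : SimpleGraph W} (h : IsWeaklySaturated G H F) (hFF' : F ≤ F') (hF'G : F' ≤ G) :
    IsWeaklySaturated G H F' := by
  rw [isWeaklySaturated_iff_forall_closed] at h ⊢
  exact ⟨hF'G, fun E hE => h.2 E (hFF'.trans hE)⟩

theorem IsWeaklySaturated.exists_ncard_eq {V W : Type*} [Finite W] {H : SimpleGraph V}
    {G F : SimpleGraph W} (h : IsWeaklySaturated G H F) {k : ℕ} (hk : F.edgeSet.ncard ≤ k)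
    (hkG : k ≤ G.edgeSet.ncard) :
    ∃ F' : SimpleGraph W, IsWeaklySaturated G H F' ∧ F'.edgeSet.ncard = k := by
  obtain ⟨s, hFs, hsG, hs⟩ := Set.exists_subsuperset_card_eq
    (SimpleGraph.edgeSet_subset_edgeSet.2 h.1) hk hkG
  have hedge : (SimpleGraph.fromEdgeSet s).edgeSet = s := by
    rw [SimpleGraph.edgeSet_fromEdgeSet, sdiff_eq_left, Set.disjoint_left]
    exact fun e he => G.not_isDiag_of_mem_edgeSet (hsG he)
  refine ⟨SimpleGraph.fromEdgeSet s, h.mono ?_ ?_, by rw [hedge, hs]⟩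
  · rwa [← SimpleGraph.edgeSet_subset_edgeSet, hedge]
  · rwa [← SimpleGraph.edgeSet_subset_edgeSet, hedge]

/-! ### Spreading the process from cliques. -/

/-- If `v` is joined in a closed graph `F` to `δ(H) - 1` vertices of a clique `Q` of order at least
`|V(H)| - 1`, then it is joined in `F` to each of its `G`-neighbours in `Q`. -/
theorem IsBootstrapClosed.adj_of_isClique {V W : Type*} [Fintype V] [Nonempty V]
    {H : SimpleGraph V} [DecidableRel H.Adj] (hδ : 0 < H.minDegree) {G F : SimpleGraph W}
    (hF : IsBootstrapClosed H G F) {Q X : Finset W} (hQ : F.IsClique (Q : Set W))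
    (hcard : Fintype.card V ≤ Q.card + 1) {v w : W} (hv : v ∉ Q) (hw : w ∈ Q)
    (hvw : G.Adj v w) (hXQ : X ⊆ Q) (hX : X.card = H.minDegree - 1)
    (hvX : ∀ x ∈ X, F.Adj v x) : F.Adj v w := by
  classical
  by_cases hwX : w ∈ X
  · exact hvX w hwX
  obtain ⟨v₀, hv₀⟩ := H.exists_minimal_degree_vertex
  have hpos : 0 < (H.neighborFinset v₀).card := by
    rw [SimpleGraph.card_neighborFinset_eq_degree]; omega
  obtain ⟨u₀, hu₀⟩ := Finset.card_pos.1 hpos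
  have hcardN : ((H.neighborFinset v₀).erase u₀).card = X.card := by
    rw [Finset.card_erase_of_mem hu₀, SimpleGraph.card_neighborFinset_eq_degree]; omega
  let e := Finset.equivOfCardEq hcardN
  -- A minimum degree vertex goes to `v`, one neighbour to `w`, the other `δ(H) - 1` neighbours to
  -- `X`. The final `v` is a junk value.
  let f₀ : V → W := fun a => if a = v₀ then v else if a = u₀ then w else
    if h : a ∈ (H.neighborFinset v₀).erase u₀ then e ⟨a, h⟩ else v
  have hadj : H.Adj v₀ u₀ := by simpa using hu₀
  have hf₀v : f₀ v₀ = v := by simp [f₀]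
  have hf₀w : f₀ u₀ = w := by simp [f₀, hadj.ne']
  have hf₀N : ∀ a (ha : a ∈ (H.neighborFinset v₀).erase u₀), f₀ a = e ⟨a, ha⟩ := by
    intro a ha
    have h₁ : a ≠ u₀ := Finset.ne_of_mem_erase ha
    have h₂ : H.Adj v₀ a := by simpa using Finset.mem_of_mem_erase ha
    simp only [f₀, if_neg h₂.ne', if_neg h₁, dif_pos ha]
  have hf₀X : ∀ a ∈ (H.neighborFinset v₀).erase u₀, f₀ a ∈ X := by
    intro a ha
    rw [hf₀N a ha]
    exact (e ⟨a, ha⟩).2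
  have hvX' : v ∉ X := fun h => hv (hXQ h)
  have hvw' : v ≠ w := fun h => hv (h ▸ hw)
  have hsub : insert v (insert w X) ⊆ insert v Q :=
    Finset.insert_subset_insert _ (Finset.insert_subset hw hXQ)
  -- With `t` of order exactly `|V(H)|`, the partial map extends to a bijection onto `t`, and
  -- everything except `v₀` lands in the clique `Q`.
  obtain ⟨t, ht₁, ht₂, ht⟩ := Finset.exists_subsuperset_card_eq (n := Fintype.card V) hsub
    (by
      have := H.minDegree_lt_card
      rw [Finset.card_insert_of_notMem (by simp [hvw', hvX']), Finset.card_insert_of_notMem hwX]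
      omega)
    (by rw [Finset.card_insert_of_notMem hv]; exact hcard)
  have hcases : ∀ a ∈ insert v₀ (H.neighborFinset v₀),
      a = v₀ ∨ a = u₀ ∨ a ∈ (H.neighborFinset v₀).erase u₀ := by
    intro a ha
    rw [Finset.mem_insert] at ha
    rw [Finset.mem_erase]
    tauto
  have hmaps : (↑(insert v₀ (H.neighborFinset v₀)) : Set V).MapsTo f₀ t := by
    intro a ha
    refine ht₁ ?_
    rcases hcases a ha with rfl | rfl | ha
    · simp [hf₀v]
    · simp [hf₀w]
    · simp [hf₀X a ha]
  have hinj : (↑(insert v₀ (H.neighborFinset v₀)) : Set V).InjOn f₀ := by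
    intro a ha b hb hab
    rcases hcases a ha with rfl | rfl | ha <;> rcases hcases b hb with rfl | rfl | hb
    · rfl
    · rw [hf₀v, hf₀w] at hab; exact absurd hab hvw'
    · rw [hf₀v] at hab; exact absurd (hab ▸ hf₀X b hb) hvX'
    · rw [hf₀v, hf₀w] at hab; exact absurd hab.symm hvw'
    · rfl
    · rw [hf₀w] at hab; exact absurd (hab ▸ hf₀X b hb) hwX
    · rw [hf₀v] at hab; exact absurd (hab ▸ hf₀X a ha) hvX'
    · rw [hf₀w] at hab; exact absurd (hab ▸ hf₀X a ha) hwX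
    · rw [hf₀N a ha, hf₀N b hb] at hab
      simpa using e.injective (Subtype.ext hab)
  obtain ⟨g, hg⟩ := hmaps.exists_equiv_extend_of_card_eq ht.symm hinj
  have hgv : (g v₀ : W) = v := by rw [hg v₀ (by simp), hf₀v]
  have hgw : (g u₀ : W) = w := by rw [hg u₀ (by simp [hadj]), hf₀w]
  have hginj : Function.Injective fun a => (g a : W) :=
    Subtype.val_injective.comp g.injective
  have hgQ : ∀ a, a ≠ v₀ → (g a : W) ∈ Q := by
    intro a ha
    refine (Finset.mem_insert.1 (ht₂ (g a).2)).resolve_left fun h => ha (hginj ?_)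
    simpa only [hgv] using h
  have hgN : ∀ a, H.Adj v₀ a → (F ⊔ SimpleGraph.edge v w).Adj v (g a) := by
    intro a ha
    rw [SimpleGraph.sup_adj]
    rcases hcases a (by simp [ha]) with rfl | rfl | ha'
    · exact absurd ha (H.irrefl)
    · right
      rw [hgw, SimpleGraph.edge_adj]
      exact ⟨Or.inl ⟨rfl, rfl⟩, hvw'⟩
    · left
      rw [hg a (by simp [ha])]
      exact hvX _ (hf₀X a ha')
  let c : SimpleGraph.Copy H (F ⊔ SimpleGraph.edge v w) := ⟨⟨fun a => (g a : W), by
    intro a b hab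
    by_cases ha : a = v₀
    · subst ha
      simpa only [hgv] using hgN b hab
    by_cases hb : b = v₀
    · subst hb
      simpa only [hgv] using (hgN a hab.symm).symm
    · exact Or.inl (hQ (hgQ a ha) (hgQ b hb) (hginj.ne hab.ne))⟩, hginj⟩
  exact hF v w hvw c v₀ u₀ hadj hgv hgw

/-- Any at most `r` vertices of `G` have a common neighbour. -/
def HasCommonNeighbors {W : Type*} (G : SimpleGraph W) (r : ℕ) : Prop :=
  ∀ T : Finset W, T.card ≤ r → ∃ y, ∀ t ∈ T, G.Adj y t

theorem HasCommonNeighbors.exists_isClique {W : Type*} {G : SimpleGraph W} {r : ℕ}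
    (hG : HasCommonNeighbors G r) (T : Finset W) (k : ℕ) (hk : T.card + k ≤ r) :
    ∃ Y : Finset W, Y.card = k ∧ G.IsClique (Y : Set W) ∧ ∀ y ∈ Y, ∀ t ∈ T, G.Adj y t := by
  classical
  induction k with
  | zero => exact ⟨∅, by simp⟩
  | succ k ih =>
    obtain ⟨Y, hYc, hY, hYT⟩ := ih (by omega)
    obtain ⟨y, hy⟩ := hG (T ∪ Y) ((Finset.card_union_le _ _).trans (by omega))
    have hyY : y ∉ Y := fun h => (hy y (by simp [h])).ne rfl
    refine ⟨insert y Y, by rw [Finset.card_insert_of_notMem hyY, hYc], ?_, ?_⟩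
    · rw [Finset.coe_insert, SimpleGraph.isClique_insert]
      exact ⟨hY, fun b hb _ => hy b (by simp [Finset.mem_coe.1 hb])⟩
    · intro z hz t ht
      rcases Finset.mem_insert.1 hz with rfl | hz
      · exact hy t (by simp [ht])
      · exact hYT z hz t ht

theorem SimpleGraph.IsClique.insert_of_adj {W : Type*} [DecidableEq W] {G : SimpleGraph W}
    {Y : Finset W} {w : W} (hY : G.IsClique (Y : Set W)) (h : ∀ y ∈ Y, G.Adj w y) :
    G.IsClique (↑(Insert.insert w Y) : Set W) := by
  rw [Finset.coe_insert, SimpleGraph.isClique_insert]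
  exact ⟨hY, fun b hb _ => h b hb⟩

/-- A closed graph containing a large clique `K` and, for every vertex `v` outside `K`, a star with
`δ(H) - 1` leaves suitably placed with respect to `K`, is the whole host graph. -/
theorem IsBootstrapClosed.eq_of_stars {V W : Type*} [Fintype V] [Nonempty V]
    {H : SimpleGraph V} [DecidableRel H.Adj] (hδ : 0 < H.minDegree) {G F : SimpleGraph W}
    (hF : IsBootstrapClosed H G F) (hFG : F ≤ G) {K : Finset W} (hK : F.IsClique (K : Set W))
    (hKc : Fintype.card V ≤ K.card)
    (hG : HasCommonNeighbors G (K.card + 3 * Fintype.card V))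
    (X : W → Finset W) (hX : ∀ v ∉ K, (X v).card = H.minDegree - 1)
    (hFX : ∀ v ∉ K, ∀ x ∈ X v, F.Adj v x)
    (hXin : ∀ v ∉ K, (∀ k ∈ K, G.Adj v k) → X v ⊆ K)
    (hXout : ∀ v ∉ K, ¬ (∀ k ∈ K, G.Adj v k) →
      G.IsClique (X v : Set W) ∧ ∀ x ∈ X v, ∀ k ∈ K, G.Adj x k) :
    F = G := by
  classical
  have hδV := H.minDegree_lt_card
  have notMem : ∀ v, (∀ k ∈ K, G.Adj v k) → v ∉ K := fun v hv h => (hv v h).ne rfl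
  have hBK : ∀ v, (∀ k ∈ K, G.Adj v k) → ∀ w ∈ K, F.Adj v w := fun v hv w hw =>
    hF.adj_of_isClique hδ hK (by omega) (notMem v hv) hw (hv w hw) (hXin v (notMem v hv) hv)
      (hX v (notMem v hv)) (hFX v (notMem v hv))
  have hBB : ∀ v w, (∀ k ∈ K, G.Adj v k) → (∀ k ∈ K, G.Adj w k) → G.Adj v w → F.Adj v w := by
    intro v w hv hw hvw
    obtain ⟨Z, hZK, hZ⟩ := Finset.exists_subset_card_eq (s := K) (n := H.minDegree - 1) (by omega)
    refine hF.adj_of_isClique hδ (Q := insert w K) (X := Z)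
      (hK.insert_of_adj (hBK w hw)) ?_ ?_ (by simp) hvw (hZK.trans (by simp)) hZ
      fun x hx => hBK v hv x (hZK hx)
    · rw [Finset.card_insert_of_notMem (notMem w hw)]; omega
    · simp [hvw.ne, notMem v hv]
  -- `K` together with its common neighbours; here `F` already agrees with `G`.
  let A : Set W := {a | a ∈ K ∨ ∀ k ∈ K, G.Adj a k}
  have hAA : ∀ a ∈ A, ∀ b ∈ A, G.Adj a b → F.Adj a b := by
    rintro a (ha | ha) b (hb | hb) hab
    · exact hK ha hb hab.ne
    · exact (hBK b hb a ha).symm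
    · exact hBK a ha b hb
    · exact hBB a b ha hb hab
  have hAclique : ∀ Q : Finset W, (∀ a ∈ Q, a ∈ A) → G.IsClique (Q : Set W) →
      F.IsClique (Q : Set W) := fun Q hQA hQ a ha b hb hab =>
    hAA a (hQA a ha) b (hQA b hb) (hQ ha hb hab)
  have hXc : ∀ v ∉ K, (X v).card < Fintype.card V := fun v hv => by rw [hX v hv]; omega
  -- The neighbours in `A` that are adjacent to the whole star.
  have hstar : ∀ v, v ∉ A → ∀ w ∈ A, G.Adj v w → (∀ x ∈ X v, G.Adj w x) → F.Adj v w := by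
    intro v hv w hw hvw hwX
    have hvK : v ∉ K := fun h => hv (Or.inl h)
    obtain ⟨hXcl, hXK⟩ := hXout v hvK fun h => hv (Or.inr h)
    -- `Y` enlarges the clique `insert w (X v)` within `A` to the order needed for a copy of `H`.
    obtain ⟨Y, hYc, hY, hYT⟩ := hG.exists_isClique (K ∪ insert w (X v)) (Fintype.card V) (by
      have := Finset.card_union_le K (insert w (X v))
      have := Finset.card_insert_le w (X v)
      have := hXc v hvK
      omega)
    have hQA : ∀ a ∈ insert w (X v) ∪ Y, a ∈ A := by
      intro a ha
      rw [Finset.mem_union, Finset.mem_insert] at ha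
      rcases ha with (rfl | ha) | ha
      · exact hw
      · exact Or.inr (hXK a ha)
      · exact Or.inr fun k hk => hYT a ha k (by simp [hk])
    refine hF.adj_of_isClique hδ (Q := insert w (X v) ∪ Y) (X := X v) (hAclique _ hQA ?_) ?_
      (fun h => hv (hQA v h)) (by simp) hvw (fun x hx => by simp [hx]) (hX v hvK) (hFX v hvK)
    · have h₁ := hXcl.insert_of_adj hwX
      intro a ha b hb hab
      rw [Finset.mem_coe, Finset.mem_union] at ha hb
      rcases ha with ha | ha <;> rcases hb with hb | hb
      · exact h₁ ha hb hab
      · exact (hYT b hb a (Finset.mem_union_right _ ha)).symm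
      · exact hYT a ha b (Finset.mem_union_right _ hb)
      · exact hY ha hb hab
    · have := Finset.card_le_card (Finset.subset_union_right (s₁ := insert w (X v)) (s₂ := Y))
      omega
  have hout : ∀ v, v ∉ A → ∀ w ∈ A, G.Adj v w → F.Adj v w := by
    intro v hv w hw hvw
    have hvK : v ∉ K := fun h => hv (Or.inl h)
    -- A general `w` need not see the star of `v`, but each vertex of `Z` does. So `hstar` joins `v`
    -- to `Z`, and `Z` then takes over the role of the star.
    obtain ⟨Z, hZc, hZ, hZT⟩ := hG.exists_isClique (K ∪ insert v (insert w (X v)))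
      (Fintype.card V) (by
      have := Finset.card_union_le K (insert v (insert w (X v)))
      have := Finset.card_insert_le v (insert w (X v))
      have := Finset.card_insert_le w (X v)
      have := hXc v hvK
      omega)
    have hZA : ∀ z ∈ Z, z ∈ A := fun z hz => Or.inr fun k hk => hZT z hz k (by simp [hk])
    have hvZ : ∀ z ∈ Z, F.Adj v z := fun z hz => hstar v hv z (hZA z hz)
      (hZT z hz v (by simp)).symm fun x hx => hZT z hz x (by simp [hx])
    have hQA : ∀ a ∈ insert w Z, a ∈ A := by
      intro a ha
      rcases Finset.mem_insert.1 ha with rfl | ha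
      exacts [hw, hZA a ha]
    obtain ⟨X', hX'Z, hX'⟩ := Finset.exists_subset_card_eq (s := Z) (n := H.minDegree - 1)
      (by omega)
    refine hF.adj_of_isClique hδ (Q := insert w Z) (X := X')
      (hAclique _ hQA (hZ.insert_of_adj fun z hz => (hZT z hz w (by simp)).symm)) ?_
      (fun h => hv (hQA v h)) (by simp) hvw (hX'Z.trans (by simp)) hX'
      fun x hx => hvZ x (hX'Z hx)
    have := Finset.card_le_card (Finset.subset_insert w Z)
    omega
  refine le_antisymm hFG fun v w hvw => ?_
  by_cases hv : v ∈ A <;> by_cases hw : w ∈ A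
  · exact hAA v hv w hw hvw
  · exact (hout w hw v hv hvw.symm).symm
  · exact hout v hv w hw hvw
  -- For two vertices outside `A`, common neighbours in `A` serve as the clique, by `hout`.
  · obtain ⟨Y, hYc, hY, hYT⟩ := hG.exists_isClique (K ∪ {v, w}) (Fintype.card V) (by
      have := Finset.card_union_le K {v, w}
      have := Finset.card_le_two (a := v) (b := w)
      omega)
    have hYA : ∀ y ∈ Y, y ∈ A := fun y hy => Or.inr fun k hk => hYT y hy k (by simp [hk])
    obtain ⟨X', hX'Y, hX'⟩ := Finset.exists_subset_card_eq (s := Y) (n := H.minDegree - 1)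
      (by omega)
    refine hF.adj_of_isClique hδ (Q := insert w Y) (X := X')
      ((hAclique Y hYA hY).insert_of_adj fun y hy =>
        hout w hw y (hYA y hy) (hYT y hy w (by simp)).symm) ?_ ?_ (by simp) hvw
      (hX'Y.trans (by simp)) hX'
      fun x hx => hout v hv x (hYA x (hX'Y hx)) (hYT x (hX'Y hx) v (by simp)).symm
    · have := Finset.card_le_card (Finset.subset_insert w Y)
      omega
    · rw [Finset.mem_insert, not_or]
      exact ⟨hvw.ne, fun h => hv (hYA v h)⟩

/-- A weakly `(K_m, H)`-saturated graph can be extended, at the cost of `δ(H) - 1` edges per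
additional vertex, to a weakly saturated subgraph of any graph with many common neighbours. -/
theorem HasCommonNeighbors.exists_isWeaklySaturated {V W : Type*} [Fintype V] [Nonempty V]
    [Fintype W] {H : SimpleGraph V} [DecidableRel H.Adj] (hδ : 0 < H.minDegree) {m : ℕ}
    {F₀ : SimpleGraph (Fin m)} (hF₀ : IsWeaklySaturated ⊤ H F₀) (hm : Fintype.card V ≤ m)
    {G : SimpleGraph W} (hG : HasCommonNeighbors G (m + 3 * Fintype.card V)) :
    ∃ F : SimpleGraph W, IsWeaklySaturated G H F ∧
      F.edgeSet.ncard ≤ F₀.edgeSet.ncard + (Fintype.card W - m) * (H.minDegree - 1) := by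
  classical
  have hδV := H.minDegree_lt_card
  obtain ⟨K, hKc, hK, -⟩ := hG.exists_isClique ∅ m (by simp)
  let ι : Fin m ↪ W := (K.equivFinOfCardEq hKc).symm.toEmbedding.trans (Function.Embedding.subtype _)
  have hιK : ∀ i, ι i ∈ K := fun i => ((K.equivFinOfCardEq hKc).symm i).2
  have hKι : ∀ k ∈ K, ∃ i, ι i = k := fun k hk => ⟨K.equivFinOfCardEq hKc ⟨k, hk⟩, by simp [ι]⟩
  have hex : ∀ v, ∃ X : Finset W, v ∉ K → X.card = H.minDegree - 1 ∧ (∀ x ∈ X, G.Adj v x) ∧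
      ((∀ k ∈ K, G.Adj v k) → X ⊆ K) ∧ (¬ (∀ k ∈ K, G.Adj v k) →
        G.IsClique (X : Set W) ∧ ∀ x ∈ X, ∀ k ∈ K, G.Adj x k) := by
    intro v
    by_cases hv : ∀ k ∈ K, G.Adj v k
    · obtain ⟨X, hXK, hX⟩ := Finset.exists_subset_card_eq (s := K) (n := H.minDegree - 1)
        (by omega)
      exact ⟨X, fun _ => ⟨hX, fun x hx => hv x (hXK hx), fun _ => hXK, fun h => absurd hv h⟩⟩
    · obtain ⟨X, hXc, hX, hXT⟩ := hG.exists_isClique (insert v K) (H.minDegree - 1) (by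
        have := Finset.card_insert_le v K
        omega)
      exact ⟨X, fun _ => ⟨hXc, fun x hx => (hXT x hx v (by simp)).symm, fun h => absurd h hv,
        fun _ => ⟨hX, fun x hx k hk => hXT x hx k (by simp [hk])⟩⟩⟩
  choose X hX using hex
  let E : Finset (Sym2 W) := Kᶜ.biUnion fun v => (X v).image fun x => s(v, x)
  let F : SimpleGraph W := F₀.map ι ⊔ SimpleGraph.fromEdgeSet (E : Set (Sym2 W))
  have hFG : F ≤ G := by
    refine sup_le (fun a b hab => ?_) (fun a b hab => ?_)
    · obtain ⟨-, i, j, hij, rfl, rfl⟩ := hab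
      exact hK (hιK i) (hιK j) (ι.injective.ne hij.ne)
    · obtain ⟨v, hv, hab'⟩ := Finset.mem_biUnion.1 hab.1
      obtain ⟨x, hx, hvx⟩ := Finset.mem_image.1 hab'
      rw [← SimpleGraph.mem_edgeSet, ← hvx]
      exact (hX v (by simpa using hv)).2.1 x hx
  refine ⟨F, isWeaklySaturated_iff_forall_closed.2 ⟨hFG, fun F' hFF' hF'G hF' => ?_⟩, ?_⟩
  · have hcomap : (⊤ : SimpleGraph (Fin m)) ≤ F'.comap ι := by
      refine hF'.le_comap_of_reflTransGen ι hF₀.2 ?_ ?_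
      · exact SimpleGraph.map_le_iff_le_comap _ _ _ |>.1 (le_sup_left.trans hFF')
      · intro i j hij
        exact hK (hιK i) (hιK j) (ι.injective.ne hij.ne)
    refine hF'.eq_of_stars hδ hF'G (K := K) ?_ (by omega) (by rwa [hKc]) X
      (fun v hv => (hX v hv).1) ?_ (fun v hv => (hX v hv).2.2.1) (fun v hv => (hX v hv).2.2.2)
    · intro a ha b hb hab
      obtain ⟨i, rfl⟩ := hKι a ha
      obtain ⟨j, rfl⟩ := hKι b hb
      exact hcomap (show (⊤ : SimpleGraph (Fin m)).Adj i j from fun h => hab (congrArg ι h))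
    · intro v hv x hx
      refine hFF' (Or.inr ⟨?_, ((hX v hv).2.1 x hx).ne⟩)
      exact Finset.mem_biUnion.2 ⟨v, by simpa using hv, Finset.mem_image_of_mem _ hx⟩
  · have h₁ : F.edgeSet ⊆ (F₀.map ι).edgeSet ∪ (E : Set (Sym2 W)) := by
      rw [SimpleGraph.edgeSet_sup, SimpleGraph.edgeSet_fromEdgeSet]
      exact Set.union_subset_union_right _ Set.sdiff_subset
    have h₂ : E.card ≤ (Fintype.card W - m) * (H.minDegree - 1) := by
      rw [← hKc, ← Finset.card_compl]
      refine Finset.card_biUnion_le_card_mul _ _ _ fun v hv => ?_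
      exact Finset.card_image_le.trans (hX v (by simpa using hv)).1.le
    calc F.edgeSet.ncard ≤ ((F₀.map ι).edgeSet ∪ (E : Set (Sym2 W))).ncard :=
          Set.ncard_le_ncard h₁ (Set.toFinite _)
      _ ≤ (F₀.map ι).edgeSet.ncard + (E : Set (Sym2 W)).ncard := Set.ncard_union_le _ _
      _ ≤ _ := by
        rw [SimpleGraph.edgeSet_map, Set.ncard_coe_finset,
          Set.ncard_image_of_injective _ ι.sym2Map.injective]
        omega

/-! ### Common neighbours in the random graph. -/

open MeasureTheory ProbabilityTheory unitInterval in
theorem SimpleGraph.binomialRandom_subset_edgeSet {W : Type*} [Finite W] (p : unitInterval)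
    (s : Finset (Sym2 W)) (hs : ∀ e ∈ s, ¬ e.IsDiag) :
    binomialRandom W p {G | ∀ e ∈ s, e ∈ G.edgeSet} = (toNNReal p : ENNReal) ^ s.card := by
  have hmeas : MeasurableSet {G : SimpleGraph W | ∀ e ∈ s, e ∈ G.edgeSet} :=
    measurableSet_setOfPred.2 (by fun_prop)
  rw [binomialRandom_eq_map, setBernoulli_eq_map, Measure.map_map (by fun_prop) (by fun_prop),
    Measure.map_apply (by fun_prop) hmeas]
  have hpre : ((fromEdgeSet : Set (Sym2 W) → SimpleGraph W) ∘ fun P : Sym2 W → Prop => {e | P e}) ⁻¹'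
      {G : SimpleGraph W | ∀ e ∈ s, e ∈ G.edgeSet} =
      Set.pi (s : Set (Sym2 W)) fun _ => {True} := by
    ext P
    simp only [Function.comp_def, Set.mem_preimage, Set.mem_ofPred_eq, edgeSet_fromEdgeSet,
      Set.mem_sdiff, Set.mem_pi, Finset.mem_coe, Set.mem_singleton_iff, eq_iff_iff, iff_true]
    exact forall₂_congr fun e he => ⟨fun h => h.1, fun h => ⟨h, hs e he⟩⟩
  rw [hpre, Measure.infinitePi_pi _ (fun _ _ => .singleton _), ← Finset.prod_const]
  refine Finset.prod_congr rfl fun e he => ?_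
  have := hs e he
  simp [this]

open MeasureTheory ProbabilityTheory unitInterval in
/-- The probability that no vertex outside `T` is adjacent to all vertices of `T`. -/
theorem SimpleGraph.binomialRandom_forall_not_forall_adj {W : Type*} [Fintype W]
    (p : unitInterval) (T : Finset W) :
    binomialRandom W p {G | ∀ y ∉ T, ¬ ∀ t ∈ T, G.Adj y t} =
      (1 - (toNNReal p : ENNReal) ^ T.card) ^ (Fintype.card W - T.card) := by
  classical
  let E : {y // y ∉ T} → Finset (Sym2 W) := fun y => T.image fun t => s(y.1, t)
  have hEdiag : ∀ y, ∀ e ∈ E y, ¬ e.IsDiag := by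
    rintro ⟨y, hy⟩ e he
    obtain ⟨t, ht, rfl⟩ := Finset.mem_image.1 he
    rw [Sym2.mk_isDiag_iff]
    rintro rfl
    exact hy ht
  have hEcard : ∀ y, (E y).card = T.card := fun y =>
    Finset.card_image_of_injective _ fun a b hab => Sym2.congr_right.1 hab
  have hEdisj : Pairwise fun y z => Disjoint (E y) (E z) := by
    rintro ⟨y, hy⟩ ⟨z, hz⟩ hyz
    rw [Finset.disjoint_left]
    intro e hey hez
    obtain ⟨t, ht, rfl⟩ := Finset.mem_image.1 hey
    obtain ⟨t', ht', h⟩ := Finset.mem_image.1 hez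
    rcases Sym2.eq_iff.1 h with ⟨h, -⟩ | ⟨h, -⟩
    · exact hyz (Subtype.ext h.symm)
    · exact hz ((show z = t from h) ▸ ht)
  let A : {y // y ∉ T} → Set (SimpleGraph W) := fun y => {G | ∀ e ∈ E y, e ∈ G.edgeSet}
  have hA : ∀ y, MeasurableSet (A y) := fun y => measurableSet_setOfPred.2 (by fun_prop)
  have hμA : ∀ y, binomialRandom W p (A y) = (toNNReal p : ENNReal) ^ T.card := fun y => by
    rw [binomialRandom_subset_edgeSet p _ (hEdiag y), hEcard]
  -- Distinct `y` outside `T` use disjoint sets of edges to `T`.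
  have hindep : iIndepSet A (binomialRandom W p) := by
    rw [iIndepSet_iff_meas_biInter hA]
    intro S
    have hInter : ⋂ y ∈ S, A y = {G | ∀ e ∈ S.biUnion E, e ∈ G.edgeSet} := by
      ext G
      simp only [A, Set.mem_iInter, Set.mem_ofPred_eq, Finset.mem_biUnion]
      exact ⟨fun h e ⟨y, hy, he⟩ => h y hy e he, fun h y hy e he => h e ⟨y, hy, he⟩⟩
    rw [hInter, binomialRandom_subset_edgeSet, Finset.card_biUnion fun y _ z _ h => hEdisj h,
      ← Finset.prod_pow_eq_pow_sum]
    · exact Finset.prod_congr rfl fun y _ => by rw [hμA, hEcard]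
    · intro e he
      obtain ⟨y, -, he⟩ := Finset.mem_biUnion.1 he
      exact hEdiag y e he
  have hset : {G : SimpleGraph W | ∀ y ∉ T, ¬ ∀ t ∈ T, G.Adj y t} =
      ⋂ y ∈ (Finset.univ : Finset {y // y ∉ T}), (A y)ᶜ := by
    ext G
    simp [A, E]
  rw [hset, (iIndepSet_iff _ _).1 hindep Finset.univ fun y _ =>
    (MeasurableSpace.measurableSet_generateFrom (Set.mem_singleton _)).compl]
  simp_rw [prob_compl_eq_one_sub (hA _), hμA]
  rw [Finset.prod_const, Finset.card_univ, Fintype.card_subtype_compl]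
  simp

open MeasureTheory ProbabilityTheory unitInterval in
-- Union bound over sets of size exactly `r`; a smaller bad set stays bad when enlarged.
theorem SimpleGraph.binomialRandom_not_hasCommonNeighbors_le (p : unitInterval) {n r : ℕ}
    (hrn : r ≤ n) :
    binomialRandom (Fin n) p {G | ¬ HasCommonNeighbors G r} ≤
      (n : ENNReal) ^ r * (1 - (toNNReal p : ENNReal) ^ r) ^ (n - r) := by
  have hsub : {G : SimpleGraph (Fin n) | ¬ HasCommonNeighbors G r} ⊆
      ⋃ T ∈ Finset.powersetCard r (Finset.univ : Finset (Fin n)),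
        {G | ∀ y ∉ T, ¬ ∀ t ∈ T, G.Adj y t} := by
    intro G hG
    simp only [HasCommonNeighbors, Set.mem_ofPred_eq, not_forall, not_exists] at hG
    obtain ⟨T, hT, h⟩ := hG
    obtain ⟨T', hTT', hT'⟩ := Finset.exists_superset_card_eq hT (by simpa using hrn)
    simp only [Set.mem_iUnion]
    refine ⟨T', by simp [Finset.mem_powersetCard, hT'], fun y _ hy => ?_⟩
    obtain ⟨t, ht, hyt⟩ := h y
    exact hyt (hy t (hTT' ht))
  calc _ ≤ _ := measure_mono hsub
    _ ≤ ∑ T ∈ Finset.powersetCard r (Finset.univ : Finset (Fin n)),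
        binomialRandom (Fin n) p {G | ∀ y ∉ T, ¬ ∀ t ∈ T, G.Adj y t} :=
      measure_biUnion_finset_le _ _
    _ = ∑ T ∈ Finset.powersetCard r (Finset.univ : Finset (Fin n)),
        (1 - (toNNReal p : ENNReal) ^ r) ^ (n - r) := by
      refine Finset.sum_congr rfl fun T hT => ?_
      rw [binomialRandom_forall_not_forall_adj, (Finset.mem_powersetCard.1 hT).2, Fintype.card_fin]
    _ ≤ _ := by
      rw [Finset.sum_const, Finset.card_powersetCard, Finset.card_univ, Fintype.card_fin,
        nsmul_eq_mul]
      gcongr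
      exact_mod_cast Nat.choose_le_pow n r

open MeasureTheory ProbabilityTheory unitInterval in
theorem SimpleGraph.tendsto_binomialRandom_not_hasCommonNeighbors {p : unitInterval} (hp : 0 < p)
    (r : ℕ) :
    Tendsto (fun n : ℕ => binomialRandom (Fin n) p {G | ¬ HasCommonNeighbors G r}) atTop (𝓝 0) := by
  have hp' : 0 < (p : ℝ) := hp
  have hp1 : (p : ℝ) ^ r ≤ 1 := pow_le_one₀ p.2.1 p.2.2
  have hppos : 0 < (p : ℝ) ^ r := by positivity
  have hreal : Tendsto (fun n : ℕ => (n : ℝ) ^ r * (1 - (p : ℝ) ^ r) ^ (n - r)) atTop (𝓝 0) := by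
    -- The case `p ^ r = 1` is separate because the other one divides by `(1 - p ^ r) ^ r`.
    rcases hp1.eq_or_lt with h | h
    · refine tendsto_const_nhds.congr' ?_
      filter_upwards [eventually_gt_atTop r] with n hn
      rw [h, sub_self, zero_pow (by omega), mul_zero]
    · have h₀ := (tendsto_pow_const_mul_const_pow_of_lt_one r (sub_nonneg.2 hp1)
        (sub_lt_self 1 hppos)).mul_const ((1 - (p : ℝ) ^ r) ^ r)⁻¹
      rw [zero_mul] at h₀
      refine h₀.congr' ?_
      filter_upwards [eventually_ge_atTop r] with n hn
      rw [pow_sub₀ _ (sub_pos.2 h).ne' hn, mul_assoc]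
  have hennreal := ENNReal.tendsto_ofReal hreal
  rw [ENNReal.ofReal_zero] at hennreal
  refine tendsto_of_tendsto_of_tendsto_of_le_of_le' tendsto_const_nhds hennreal
    (Eventually.of_forall fun _ => zero_le) ?_
  filter_upwards [eventually_ge_atTop r] with n hn
  refine (binomialRandom_not_hasCommonNeighbors_le p hn).trans_eq ?_
  have hq : (toNNReal p : ENNReal) = ENNReal.ofReal (p : ℝ) := by
    rw [ENNReal.ofReal, ENNReal.coe_inj]
    exact (Real.toNNReal_of_nonneg p.2.1).symm
  rw [ENNReal.ofReal_mul (by positivity), ENNReal.ofReal_pow (by positivity),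
    ENNReal.ofReal_natCast, ENNReal.ofReal_pow (sub_nonneg.2 hp1),
    ENNReal.ofReal_sub _ hppos.le, ENNReal.ofReal_one, ENNReal.ofReal_pow p.2.1, hq]

/-! ### Edge counts and the conclusion. -/

theorem SimpleGraph.card_mul_le_ncard_edgeSet {W : Type*} [Fintype W] (F : SimpleGraph W)
    (S : Finset W) (d : ℕ) (h : ∀ v ∉ S, d ≤ {w | w ∈ S ∧ F.Adj v w}.ncard) :
    (Fintype.card W - S.card) * d ≤ F.edgeSet.ncard := by
  classical
  have hdisj : ∀ v ∉ S, ∀ v' ∉ S, v ≠ v' →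
      Disjoint ((S.filter (F.Adj v)).image fun w => s(v, w))
        ((S.filter (F.Adj v')).image fun w => s(v', w)) := by
    intro v hv v' hv' hne
    rw [Finset.disjoint_left]
    intro e he he'
    obtain ⟨w, hw, rfl⟩ := Finset.mem_image.1 he
    obtain ⟨w', hw', h⟩ := Finset.mem_image.1 he'
    rcases Sym2.eq_iff.1 h with ⟨h, -⟩ | ⟨h, -⟩
    · exact hne h.symm
    · exact hv' (h ▸ (Finset.mem_filter.1 hw).1)
  calc (Fintype.card W - S.card) * d
      ≤ (Sᶜ.biUnion fun v => (S.filter (F.Adj v)).image fun w => s(v, w)).card := by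
        rw [← Finset.card_compl, Finset.card_biUnion fun v hv v' hv' hne =>
          hdisj v (by simpa using hv) v' (by simpa using hv') hne, ← smul_eq_mul]
        refine Finset.card_nsmul_le_sum _ _ _ fun v hv => ?_
        rw [Finset.card_image_of_injective _ fun a b hab => Sym2.congr_right.1 hab]
        refine (h v (by simpa using hv)).trans_eq ?_
        rw [← Set.ncard_coe_finset]
        congr 1
        ext w
        simp
    _ ≤ F.edgeSet.ncard := by
        rw [← Set.ncard_coe_finset]
        refine Set.ncard_le_ncard ?_ (Set.toFinite _)
        intro e he
        obtain ⟨v, -, he⟩ := Finset.mem_biUnion.1 he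
        obtain ⟨w, hw, rfl⟩ := Finset.mem_image.1 he
        exact (Finset.mem_filter.1 hw).2

/-- If `e n ≥ d * (n - c)` for all `n`, then the excess `e n - d * n` attains its minimum over
`n ≥ h` at some `m`. -/
theorem exists_forall_le_add_mul (e : ℕ → ℕ) (c d h : ℕ) (he : ∀ n, (n - c) * d ≤ e n) :
    ∃ m, h ≤ m ∧ ∀ n, m ≤ n → e m + (n - m) * d ≤ e n := by
  have hle : ∀ n, n * d ≤ e n + c * d := fun n => by
    have := he n
    rw [Nat.sub_mul] at this
    omega
  -- The shift by `c * d` makes the excess a natural number, so the subtraction never truncates.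
  obtain ⟨m, hm, hmin⟩ := (measure fun n => e n + c * d - n * d).wf.has_min (Set.Ici h) ⟨h, Set.mem_Ici.2 le_rfl⟩
  refine ⟨m, hm, fun n hn => ?_⟩
  have h₁ : ¬ e n + c * d - n * d < e m + c * d - m * d := hmin n (le_trans hm hn)
  have h₂ := hle n
  have h₃ := hle m
  have h₄ := Nat.mul_le_mul_right d hn
  rw [Nat.sub_mul]
  omega

theorem theorem1 {V : Type*} [Fintype V] (H : SimpleGraph V) [DecidableRel H.Adj]
    (hH : ∀ v : V, ¬ H.IsIsolated v)
    (p : unitInterval) (hp0 : 0 < p) (hp1 : p < 1) (C : ℝ) (hC : 0 < C)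
    (F₀ : ∀ n : ℕ, SimpleGraph (Fin n)) (S₀ : ∀ n : ℕ, Finset (Fin n))
    (hF₀ : ∀ n : ℕ, IsWeaklySaturated (⊤ : SimpleGraph (Fin n)) H (F₀ n))
    (hS₀ : ∀ n : ℕ, ((S₀ n).card : ℝ) ≤ C)
    (hdeg : ∀ n : ℕ, ∀ v : Fin n, v ∉ S₀ n →
      H.minDegree - 1 ≤ {w | w ∈ S₀ n ∧ (F₀ n).Adj v w}.ncard) :
    Tendsto (fun n : ℕ => SimpleGraph.binomialRandom (Fin n) p
        {G | ∃ F : SimpleGraph (Fin n), IsWeaklySaturated G H F ∧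
          F.edgeSet.ncard = min G.edgeSet.ncard (F₀ n).edgeSet.ncard})
      atTop (𝓝 1) := by
  obtain ⟨r, N, hr⟩ : ∃ r N : ℕ, ∀ n ≥ N, ∀ G : SimpleGraph (Fin n), HasCommonNeighbors G r →
      ∃ F : SimpleGraph (Fin n), IsWeaklySaturated G H F ∧
        F.edgeSet.ncard = min G.edgeSet.ncard (F₀ n).edgeSet.ncard := by
    rcases isEmpty_or_nonempty V with hV | hV
    · refine ⟨0, 0, fun n _ G _ => ⟨G, ⟨le_rfl, .refl⟩, (min_eq_left ?_).symm⟩⟩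
      -- Without vertices `H` has no edge, so no percolation step exists.
      have htop : F₀ n = ⊤ := by
        rcases (hF₀ n).2.cases_tail with h | ⟨_, -, _, _, -, -, -, -, x, -⟩
        · exact h.symm
        · exact hV.elim x
      rw [htop]
      exact Set.ncard_le_ncard (SimpleGraph.edgeSet_subset_edgeSet.2 le_top) (Set.toFinite _)
    · have hδ : 0 < H.minDegree := Nat.pos_of_ne_zero fun h =>
        (SimpleGraph.minDegree_eq_zero_iff.1 h).elim hH
      obtain ⟨m, hm, hmin⟩ := exists_forall_le_add_mul (fun n => (F₀ n).edgeSet.ncard) ⌊C⌋₊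
        (H.minDegree - 1) (Fintype.card V) fun n => by
          have := (F₀ n).card_mul_le_ncard_edgeSet (S₀ n) _ (hdeg n)
          rw [Fintype.card_fin] at this
          exact (Nat.mul_le_mul_right _ (Nat.sub_le_sub_left (Nat.le_floor (hS₀ n)) n)).trans this
      refine ⟨m + 3 * Fintype.card V, m, fun n hn G hG => ?_⟩
      rcases le_total G.edgeSet.ncard (F₀ n).edgeSet.ncard with h | h
      · exact ⟨G, ⟨le_rfl, .refl⟩, (min_eq_left h).symm⟩
      · obtain ⟨F, hF, hFcard⟩ := hG.exists_isWeaklySaturated hδ (hF₀ m) hm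
        rw [Fintype.card_fin] at hFcard
        rw [min_eq_right h]
        exact hF.exists_ncard_eq (hFcard.trans (hmin n hn)) h
  have hbad := SimpleGraph.tendsto_binomialRandom_not_hasCommonNeighbors hp0 r
  have hlower := ENNReal.Tendsto.sub (tendsto_const_nhds (x := (1 : ENNReal))) hbad
    (Or.inl ENNReal.one_ne_top)
  rw [tsub_zero] at hlower
  refine tendsto_of_tendsto_of_tendsto_of_le_of_le' hlower tendsto_const_nhds ?_
    (Eventually.of_forall fun _ => MeasureTheory.prob_le_one)
  filter_upwards [eventually_ge_atTop N] with n hn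
  rw [tsub_le_iff_right, ← MeasureTheory.measure_univ (μ := SimpleGraph.binomialRandom (Fin n) p)]
  -- Subadditivity suffices, so the measurability of the two events plays no role.
  refine (MeasureTheory.measure_mono ?_).trans (MeasureTheory.measure_union_le _ _)
  intro G _
  by_cases hG : HasCommonNeighbors G r
  · exact Or.inl (hr n hn G hG)
  · exact Or.inr hG
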